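/- Let $p$ be a prime number and let $r \ge 0$ be an integer. Let $g(x) = x^{p^2} + p^{r+2} x^{p^2+1}$, regarded as a formal power series over $\mathbb{C}_p$. There is a unique formal power series $\phi(x) = x + O(x^2) \in \mathbb{C}_p[[x]]$ (the Böttcher coordinate of $g$) satisfying $\phi(g(x)) = \phi(x)^{p^2}$. It has a unique inverse $\phi^{-1}(x) \in \mathbb{C}_p[[x]]$ for composition of power series with zero constant term, and the radius of convergence of $\phi^{-1}(x)$ in $\mathbb{C}_p$ is $p^{-p^{-r}/(p-1)}$, where $|\cdot|_p$ is normalized by $|p|_p = p^{-1}$. -/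

import Mathlib

open scoped PowerSeries

/-- `φ` is a Böttcher coordinate of `g(x) = x^d + O(x^{d+1})`: a formal power series
`φ(x) = x + O(x²)` satisfying the Böttcher equation `φ(g(x)) = φ(x)^d`. -/
structure IsBottcherCoordinate {K : Type*} [Field K] (d : ℕ) (g φ : K⟦X⟧) : Prop where
  coeff_zero : PowerSeries.coeff 0 φ = 0
  coeff_one : PowerSeries.coeff 1 φ = 1
  subst_eq : φ.subst g = φ ^ d

/-- `ψ` is the inverse `φ⁻¹` of `φ` for composition of formal power series with vanishing
constant term: `φ(ψ(x)) = x` and `ψ(φ(x)) = x`. -/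
structure IsCompInverse {K : Type*} [Field K] (φ ψ : K⟦X⟧) : Prop where
  constantCoeff_left : PowerSeries.constantCoeff φ = 0
  constantCoeff_right : PowerSeries.constantCoeff ψ = 0
  left_subst_right : φ.subst ψ = PowerSeries.X
  right_subst_left : ψ.subst φ = PowerSeries.X

/-- The power series `g(x) = x^{p²} + p^{r+2} x^{p²+1}` over `ℂ_p`. -/
noncomputable def salernoSilvermanMap (p : ℕ) [Fact p.Prime] (r : ℕ) : ℂ_[p]⟦X⟧ :=
  PowerSeries.X ^ p ^ 2 +
    PowerSeries.C ((p : ℂ_[p]) ^ (r + 2)) * PowerSeries.X ^ (p ^ 2 + 1)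

/-- The radius of convergence in `ℂ_p` of the formal power series `f = ∑ aₙ xⁿ`: the supremum
in `[0, ∞]` of the `ρ ≥ 0` such that the sequence `|aₙ| ρⁿ` is bounded. -/
noncomputable def padicRadiusOfConvergence (p : ℕ) [Fact p.Prime] (f : ℂ_[p]⟦X⟧) : ENNReal :=
  (FormalMultilinearSeries.ofScalars ℂ_[p] (fun n => PowerSeries.coeff n f)).radius

/-!
Write `q = p ^ 2`, `a = p ^ (r + 2)`, so that `g = X ^ q (1 + a X)`, and `φ = X · exp l`. The Böttcher
equation becomes the linear equation `q l = log (1 + a X) + l(g)`, solved by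
`l = ∑ₖ q ^ (-k) · q⁻¹ log (1 + a gᵏ)` with `gᵏ` the iterates of `g`. The `k`-th term is
`p ^ (r - 2 k) X ^ (p ^ (2 k))` up to an error of at most half of its size
(`PowerSeries.gaussBound_logTerm_sub`).

On the disc of radius `R = p ^ (-p ^ (-r) / (p - 1))`, the size of this monomial is at most the radius
of convergence `e = p ^ (-1 / (p - 1))` of the `p`-adic exponential, with equality only for
`k = ⌈r / 2⌉` (`logTerm_size_eq_padicExpRadius`, `logTerm_size_le`). Hence `l` is a monomial `c X ^ N`
of size exactly `e`, up to strictly smaller terms (`PowerSeries.exists_bottcher_log`). By Legendre's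
formula the terms of `exp (c X ^ N)` have size at most `e` in positive degree, and exactly `e` in the
degrees `N pʲ`; the same then holds for `exp l = φ / X`
(`PowerSeries.gaussBound_exp_subst_and_norm_coeff`).

Put `φ = X + h`, so that `h` has Gauss norm `R e` on the disc of radius `R`. Its compositional inverse
is `ψ = X - h` up to an error of size `R e ^ 2 < R e` (`PowerSeries.gaussBound_add_sub_X`). The terms of
`ψ` are therefore bounded on the circle of radius `R`, and those of degree `N pʲ + 1` have the constant
size `R e` there, so the radius of convergence is exactly `R` (`radius_ofScalars_eq`).
-/

namespace PowerSeries

/-! ### Formal power series under composition -/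

section Formal

variable {K : Type*} [Field K]

theorem X_pow_dvd_subst {f g : K⟦X⟧} {m n : ℕ} (hm : m ≠ 0) (hg : X ^ m ∣ g) (hf : X ^ n ∣ f) :
    X ^ (m * n) ∣ f.subst g := by
  have hs : HasSubst g := HasSubst.of_constantCoeff_zero'
    (X_dvd_iff.1 ((dvd_pow_self X hm).trans hg))
  obtain ⟨f', rfl⟩ := hf
  rw [subst_mul hs, subst_pow hs, subst_X hs, pow_mul]
  exact Dvd.dvd.mul_right (pow_dvd_pow_of_dvd hg n) _

theorem eq_of_forall_X_pow_dvd_sub {f g : K⟦X⟧} (h : ∀ n, X ^ (n + 1) ∣ f - g) : f = g := by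
  ext n
  have := X_pow_dvd_iff.1 (h n) n n.lt_succ_self
  rwa [map_sub, sub_eq_zero] at this

/-- If `h` has no linear term, then `f ↦ h(f)` is a contraction for the `X`-adic distance: agreement
of `f` and `g` below degree `n` gives agreement of `h(f)` and `h(g)` up to degree `n` included. -/
theorem coeff_subst_eq_of_X_pow_dvd_sub {f g h : K⟦X⟧} {n : ℕ} (hf : constantCoeff f = 0)
    (hg : constantCoeff g = 0) (hfg : X ^ n ∣ f - g) (h1 : coeff 1 h = 0) :
    coeff n (h.subst f) = coeff n (h.subst g) := by
  rw [coeff_subst' (HasSubst.of_constantCoeff_zero' hf),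
    coeff_subst' (HasSubst.of_constantCoeff_zero' hg)]
  refine finsum_congr fun d => ?_
  rcases d with _ | _ | d
  · simp
  · simp [h1]
  · congr 1
    rw [← sub_eq_zero, ← map_sub]
    suffices hdvd : (X : K⟦X⟧) ^ (n + 1) ∣ f ^ (d + 1 + 1) - g ^ (d + 1 + 1) from
      X_pow_dvd_iff.1 hdvd n n.lt_succ_self
    have hX : X ∣ ∑ i ∈ Finset.range (d + 1 + 1), f ^ i * g ^ (d + 1 + 1 - 1 - i) := by
      refine Finset.dvd_sum fun i hi => ?_
      rcases i with _ | i
      · exact Dvd.dvd.mul_left (dvd_pow (X_dvd_iff.2 hg) (by omega)) _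
      · exact Dvd.dvd.mul_right (dvd_pow (X_dvd_iff.2 hf) (by omega)) _
    rw [← (Commute.all f g).geom_sum₂_mul, pow_succ']
    exact mul_dvd_mul hX hfg

/-- The difference `δ` of two Böttcher coordinates satisfies `δ(g) = δ · X ^ (d - 1) · s` with `s` a unit
(its constant term is `d`). Since `δ(g)` has order at least `d · ord δ`, this gives `(d - 1) · ord δ ≤ d - 1`,
which contradicts `ord δ ≥ 2` unless `δ = 0`. -/
theorem bottcherCoordinate_unique [CharZero K] {d : ℕ} (hd : 2 ≤ d) {g φ φ' : K⟦X⟧}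
    (hg : X ^ d ∣ g) (h : IsBottcherCoordinate d g φ) (h' : IsBottcherCoordinate d g φ') :
    φ' = φ := by
  obtain ⟨u, hu⟩ := X_dvd_iff.2 (coeff_zero_eq_constantCoeff_apply φ ▸ h.coeff_zero)
  obtain ⟨u', hu'⟩ := X_dvd_iff.2 (coeff_zero_eq_constantCoeff_apply φ' ▸ h'.coeff_zero)
  have hu1 : constantCoeff u = 1 := by
    have := h.coeff_one
    rwa [hu, show (1 : ℕ) = 0 + 1 from rfl, coeff_succ_X_mul, coeff_zero_eq_constantCoeff_apply] at this
  have hu1' : constantCoeff u' = 1 := by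
    have := h'.coeff_one
    rwa [hu', show (1 : ℕ) = 0 + 1 from rfl, coeff_succ_X_mul, coeff_zero_eq_constantCoeff_apply] at this
  have hs : HasSubst g := HasSubst.of_constantCoeff_zero'
    (X_dvd_iff.1 ((dvd_pow_self X (by omega)).trans hg))
  set s : K⟦X⟧ := ∑ i ∈ Finset.range d, u' ^ i * u ^ (d - 1 - i) with hsdef
  have hsu : IsUnit s := by
    rw [isUnit_iff_constantCoeff, hsdef, map_sum]
    simp only [map_mul, map_pow, hu1, hu1', one_pow, mul_one, Finset.sum_const, Finset.card_range,
      nsmul_eq_mul]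
    exact (Nat.cast_ne_zero.2 (by omega : d ≠ 0)).isUnit
  have key : (φ' - φ).subst g = (φ' - φ) * X ^ (d - 1) * s := by
    rw [subst_sub hs, h.subst_eq, h'.subst_eq, hu, hu', mul_pow, mul_pow, ← mul_sub,
      ← (Commute.all u' u).geom_sum₂_mul]
    obtain ⟨e, rfl⟩ : ∃ e, d = e + 1 := ⟨d - 1, by omega⟩
    simp only [Nat.add_sub_cancel] at hsdef ⊢
    rw [← hsdef]
    ring
  -- Agreement up to order `m + 2` improves to order `d * (m + 2) - (d - 1) ≥ m + 3`.
  have step : ∀ m, X ^ (m + 2) ∣ φ' - φ := by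
    intro m
    induction m with
    | zero =>
      refine X_pow_dvd_iff.2 fun i hi => ?_
      rcases i with _ | _ | i
      · rw [map_sub, h.coeff_zero, h'.coeff_zero, sub_zero]
      · rw [map_sub, h.coeff_one, h'.coeff_one, sub_self]
      · omega
    | succ m ih =>
      have h1 := X_pow_dvd_subst (by omega) hg ih
      rw [key, hsu.dvd_mul_right] at h1
      have h2 : (X : K⟦X⟧) ^ (m + 1 + 2) * X ^ (d - 1) ∣ (φ' - φ) * X ^ (d - 1) := by
        rw [← pow_add]
        refine (pow_dvd_pow X ?_).trans h1
        obtain ⟨e, rfl⟩ : ∃ e, d = e + 2 := ⟨d - 2, by omega⟩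
        have : (e + 2) * (m + 2) = e * (m + 2) + 2 * (m + 2) := by ring
        have : e * 2 ≤ e * (m + 2) := Nat.mul_le_mul_left _ (by omega)
        omega
      exact (mul_dvd_mul_iff_right (pow_ne_zero _ X_ne_zero)).1 h2
  exact eq_of_forall_X_pow_dvd_sub fun n => (pow_dvd_pow X (by omega)).trans (step n)

theorem isCompInverse_unique {φ ψ ψ' : K⟦X⟧} (h : IsCompInverse φ ψ) (h' : IsCompInverse φ ψ') :
    ψ' = ψ := by
  have hφ := HasSubst.of_constantCoeff_zero' h.constantCoeff_left
  have hψ := HasSubst.of_constantCoeff_zero' h.constantCoeff_right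
  have key := subst_comp_subst_apply hφ hψ ψ'
  rw [h'.right_subst_left, subst_X hψ] at key
  rw [key]
  exact (X_subst ψ').symm.trans (congrArg (fun f : K⟦X⟧ => ψ'.subst f) h.left_subst_right.symm)

theorem exists_isCompInverse {φ : K⟦X⟧} (h0 : constantCoeff φ = 0) (h1 : IsUnit (coeff 1 φ)) :
    ∃ ψ, IsCompInverse φ ψ :=
  ⟨φ.substInvOfIsUnit h1, h0, constantCoeff_substInvOfIsUnit φ h1,
    subst_substInvOfIsUnit_right φ h0 h1, subst_substInvOfIsUnit_left φ h0 h1⟩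

end Formal

/-! ### Gauss norms on ultrametric power series -/

section Gauss

variable {K : Type*} [NormedField K]

/-- The Gauss norm of `f` on the disc of radius `ρ` is at most `B`: every coefficient satisfies
`‖aₙ‖ ρⁿ ≤ B`. Stated as a predicate, it makes sense for series whose Gauss norm is infinite, and it
needs no scalar of norm `ρ`. -/
def GaussBound (ρ B : ℝ) (f : K⟦X⟧) : Prop :=
  ∀ n, ‖coeff n f‖ * ρ ^ n ≤ B

namespace GaussBound

variable {ρ B B' : ℝ} {f g : K⟦X⟧}

theorem nonneg (hf : GaussBound ρ B f) : 0 ≤ B := by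
  have := hf 0
  rw [pow_zero, mul_one] at this
  exact (norm_nonneg _).trans this

theorem mono (hf : GaussBound ρ B f) (h : B ≤ B') : GaussBound ρ B' f := fun n => (hf n).trans h

theorem monomial (hρ : 0 ≤ ρ) (c : K) (n : ℕ) : GaussBound ρ (‖c‖ * ρ ^ n) (C c * X ^ n) := by
  intro m
  rw [coeff_C_mul, coeff_X_pow]
  split_ifs with h
  · rw [h, mul_one]
  · rw [mul_zero, norm_zero, zero_mul]
    positivity

theorem X_pow (hρ : 0 ≤ ρ) (n : ℕ) : GaussBound ρ (ρ ^ n) (X ^ n : K⟦X⟧) := by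
  simpa using monomial hρ (1 : K) n

theorem X (hρ : 0 ≤ ρ) : GaussBound ρ ρ (PowerSeries.X : K⟦X⟧) := by
  simpa using X_pow (K := K) hρ 1

theorem one (hρ : 0 ≤ ρ) : GaussBound ρ 1 (1 : K⟦X⟧) := by
  simpa using X_pow (K := K) hρ 0

theorem neg (hf : GaussBound ρ B f) : GaussBound ρ B (-f) := by
  intro n
  rw [map_neg, norm_neg]
  exact hf n

theorem C_mul (hf : GaussBound ρ B f) (c : K) : GaussBound ρ (‖c‖ * B) (C c * f) := by
  intro n
  rw [coeff_C_mul, norm_mul, mul_assoc]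
  exact mul_le_mul_of_nonneg_left (hf n) (norm_nonneg _)

variable [IsUltrametricDist K]

theorem add (hf : GaussBound ρ B f) (hg : GaussBound ρ B g) (hρ : 0 ≤ ρ) :
    GaussBound ρ B (f + g) := by
  intro n
  rw [map_add]
  refine (mul_le_mul_of_nonneg_right (IsUltrametricDist.norm_add_le_max _ _)
    (pow_nonneg hρ n)).trans ?_
  rcases max_choice ‖coeff n f‖ ‖coeff n g‖ with h | h <;> rw [h]
  exacts [hf n, hg n]

theorem sub (hf : GaussBound ρ B f) (hg : GaussBound ρ B g) (hρ : 0 ≤ ρ) :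
    GaussBound ρ B (f - g) := by
  rw [sub_eq_add_neg]
  exact hf.add hg.neg hρ

theorem sum {ι : Type*} {s : Finset ι} {F : ι → K⟦X⟧} (hB : 0 ≤ B) (hρ : 0 ≤ ρ)
    (h : ∀ i ∈ s, GaussBound ρ B (F i)) : GaussBound ρ B (∑ i ∈ s, F i) := by
  classical
  induction s using Finset.induction_on with
  | empty =>
    intro n
    simpa using hB
  | insert a s ha ih =>
    rw [Finset.sum_insert ha]
    exact (h a (Finset.mem_insert_self a s)).add
      (ih fun i hi => h i (Finset.mem_insert_of_mem hi)) hρ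

theorem mul (hf : GaussBound ρ B f) (hg : GaussBound ρ B' g) (hρ : 0 ≤ ρ) :
    GaussBound ρ (B * B') (f * g) := by
  intro n
  rw [coeff_mul]
  rcases hρ.eq_or_lt with rfl | hpos
  · rcases n with _ | n
    · simpa using mul_le_mul (by simpa using hf 0) (by simpa using hg 0) (norm_nonneg _) hf.nonneg
    · simpa using mul_nonneg hf.nonneg hg.nonneg
  rw [← le_div_iff₀ (pow_pos hpos n)]
  refine IsUltrametricDist.norm_sum_le_of_forall_le_of_nonneg
    (div_nonneg (mul_nonneg hf.nonneg hg.nonneg) (pow_nonneg hρ n)) fun ij hij => ?_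
  rw [le_div_iff₀ (pow_pos hpos n), norm_mul, ← Finset.HasAntidiagonal.mem_antidiagonal.1 hij, pow_add]
  calc _ = (‖coeff ij.1 f‖ * ρ ^ ij.1) * (‖coeff ij.2 g‖ * ρ ^ ij.2) := by ring
    _ ≤ _ := mul_le_mul (hf _) (hg _) (by positivity) hf.nonneg

theorem pow (hf : GaussBound ρ B f) (hρ : 0 ≤ ρ) (n : ℕ) : GaussBound ρ (B ^ n) (f ^ n) := by
  induction n with
  | zero => simpa using one hρ
  | succ n ih =>
    rw [pow_succ, pow_succ]
    exact ih.mul hf hρ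

theorem pow_sub_pow {M c : ℝ} (hf : GaussBound ρ M f) (hg : GaussBound ρ M g)
    (hfg : GaussBound ρ (M * c) (f - g)) (hc : 0 ≤ c) (hρ : 0 ≤ ρ) (n : ℕ) :
    GaussBound ρ (M ^ n * c) (f ^ n - g ^ n) := by
  induction n with
  | zero =>
    intro m
    simpa using hc
  | succ n ih =>
    rw [show f ^ (n + 1) - g ^ (n + 1) = f ^ n * (f - g) + (f ^ n - g ^ n) * g by ring]
    refine (((hf.pow hρ n).mul hfg hρ).mono (le_of_eq ?_)).add
      ((ih.mul hg hρ).mono (le_of_eq ?_)) hρ <;> ring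

/-- A family without finite support has `finsum` zero, so no finiteness assumption is needed. -/
theorem finsum_coeff {F : ℕ → K⟦X⟧} (hB : 0 ≤ B) (hρ : 0 < ρ)
    (h : ∀ d, GaussBound ρ B (F d)) (n : ℕ) :
    ‖∑ᶠ d, coeff n (F d)‖ * ρ ^ n ≤ B := by
  rw [← le_div_iff₀ (pow_pos hρ n)]
  have h0 : 0 ≤ B / ρ ^ n := by positivity
  by_cases hfin : (Function.support fun d => coeff n (F d)).Finite
  · rw [finsum_eq_sum _ hfin]
    refine IsUltrametricDist.norm_sum_le_of_forall_le_of_nonneg h0 fun d _ => ?_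
    rw [le_div_iff₀ (pow_pos hρ n)]
    exact h d n
  · rw [finsum_of_infinite_support hfin, norm_zero]
    exact h0

theorem subst {M : ℝ} (hf : GaussBound M B f) (hg : GaussBound ρ M g) (hρ : 0 < ρ)
    (hg0 : constantCoeff g = 0) : GaussBound ρ B (f.subst g) := by
  intro n
  rw [coeff_subst' (HasSubst.of_constantCoeff_zero' hg0)]
  simp_rw [smul_eq_mul, ← coeff_C_mul]
  exact finsum_coeff hf.nonneg hρ
    (fun d => ((hg.pow hρ.le d).C_mul _).mono (hf d)) n

/-- On the closed disc of Gauss norm `M`, a series `h` of norm at most `B` contracts relative distances: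
`|h(f) - h(g)| ≤ B · |f - g| / M`. -/
theorem subst_sub_subst {M c : ℝ} {h : K⟦X⟧} (hh : GaussBound M B h) (hf : GaussBound ρ M f)
    (hg : GaussBound ρ M g) (hfg : GaussBound ρ (M * c) (f - g)) (hc : 0 ≤ c) (hρ : 0 < ρ)
    (hf0 : constantCoeff f = 0) (hg0 : constantCoeff g = 0) :
    GaussBound ρ (B * c) (h.subst f - h.subst g) := by
  have sf := HasSubst.of_constantCoeff_zero' hf0
  have sg := HasSubst.of_constantCoeff_zero' hg0
  intro n
  rw [map_sub, coeff_subst' sf, coeff_subst' sg,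
    ← finsum_sub_distrib (coeff_subst_finite' sf h n) (coeff_subst_finite' sg h n)]
  simp_rw [smul_eq_mul, ← mul_sub, ← map_sub, ← coeff_C_mul]
  refine finsum_coeff (mul_nonneg hh.nonneg hc) hρ (fun d => ?_) n
  refine ((hf.pow_sub_pow hg hfg hc hρ.le d).C_mul _).mono ?_
  rw [← mul_assoc]
  exact mul_le_mul_of_nonneg_right (hh d) hc

end GaussBound

end Gauss

/-! ### Formal exponential and logarithm -/

section ExpLog

theorem subst_subst {K : Type*} [Field K] (f : K⟦X⟧) {g h : K⟦X⟧} (hg : constantCoeff g = 0)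
    (hh : constantCoeff h = 0) :
    subst h (subst g f : K⟦X⟧) = subst (subst h g : K⟦X⟧) f :=
  subst_comp_subst_apply (HasSubst.of_constantCoeff_zero' hg) (HasSubst.of_constantCoeff_zero' hh) f

variable {K : Type*} [Field K] [CharZero K]

/-- Uniqueness for the formal differential equation `y' = a y` in characteristic zero; all identities
of the exponential below are deduced from it. -/
theorem eq_of_derivative_eq_mul {a f g : K⟦X⟧} (hf : d⁄dX K f = a * f) (hg : d⁄dX K g = a * g)
    (h0 : constantCoeff f = constantCoeff g) : f = g := by
  rw [← sub_eq_zero]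
  set D := f - g with hD
  have hder : d⁄dX K D = a * D := by rw [hD, map_sub, hf, hg, mul_sub]
  ext n
  rw [map_zero]
  induction n using Nat.strong_induction_on with
  | _ n ih =>
    rcases n with _ | n
    · rw [hD, map_sub, coeff_zero_eq_constantCoeff_apply, coeff_zero_eq_constantCoeff_apply, h0,
        sub_self]
    · have h := congrArg (coeff n) hder
      rw [coeff_derivative, coeff_mul, Finset.sum_eq_zero, mul_eq_zero] at h
      · exact h.resolve_right (by exact_mod_cast n.succ_ne_zero)
      · intro ij hij
        have := Finset.HasAntidiagonal.mem_antidiagonal.1 hij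
        rw [ih ij.2 (by omega), mul_zero]

theorem constantCoeff_exp_subst {f : K⟦X⟧} (hf : constantCoeff f = 0) :
    constantCoeff ((exp K).subst f) = 1 := by
  have h : constantCoeff ((exp K - 1).subst f) = 0 :=
    constantCoeff_subst_eq_zero hf _ (by rw [map_sub, constantCoeff_exp, map_one, sub_self])
  have hs := HasSubst.of_constantCoeff_zero' hf
  rw [subst_sub hs, ← coe_substAlgHom hs, map_one, map_sub, map_one, sub_eq_zero] at h
  rwa [← coe_substAlgHom hs]

theorem derivative_exp_subst {f : K⟦X⟧} (hf : constantCoeff f = 0) :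
    d⁄dX K ((exp K).subst f) = d⁄dX K f * (exp K).subst f := by
  rw [derivative_subst (HasSubst.of_constantCoeff_zero' hf), derivative_exp, mul_comm]

theorem exp_subst_add {f g : K⟦X⟧} (hf : constantCoeff f = 0) (hg : constantCoeff g = 0) :
    (exp K).subst (f + g) = (exp K).subst f * (exp K).subst g := by
  have hfg : constantCoeff (f + g) = 0 := by rw [map_add, hf, hg, add_zero]
  refine eq_of_derivative_eq_mul (a := d⁄dX K (f + g)) (derivative_exp_subst hfg) ?_ ?_
  · rw [Derivation.leibniz, derivative_exp_subst hf, derivative_exp_subst hg, map_add, smul_eq_mul,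
      smul_eq_mul]
    ring
  · rw [map_mul, constantCoeff_exp_subst hfg, constantCoeff_exp_subst hf,
      constantCoeff_exp_subst hg, one_mul]

theorem exp_subst_natCast_mul {f : K⟦X⟧} (hf : constantCoeff f = 0) (n : ℕ) :
    (exp K).subst ((n : K⟦X⟧) * f) = (exp K).subst f ^ n := by
  induction n with
  | zero =>
    refine eq_of_derivative_eq_mul (a := 0) ?_ ?_ ?_
    · rw [derivative_exp_subst (by simp), Nat.cast_zero, zero_mul, map_zero]
    · simp
    · rw [constantCoeff_exp_subst (by simp), pow_zero, map_one]
  | succ n ih =>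
    rw [Nat.cast_succ, add_mul, one_mul, exp_subst_add (by rw [map_mul, hf, mul_zero]) hf, ih,
      pow_succ]

theorem exp_subst_log : (exp K).subst (log K) = 1 + X := by
  refine eq_of_derivative_eq_mul (a := d⁄dX K (log K)) (derivative_exp_subst constantCoeff_log) ?_ ?_
  · rw [deriv_log, map_add, derivative_X, mul_add, mul_one]
    ext n
    rcases n with _ | n
    · simp
    · simp [coeff_succ_mul_X, pow_succ, coeff_one]
  · rw [constantCoeff_exp_subst constantCoeff_log, map_add, map_one, constantCoeff_X, add_zero]

theorem exp_subst_rescale_log (a : K) : (exp K).subst (rescale a (log K)) = 1 + C a * X := by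
  have hs : HasSubst (C a * X : K⟦X⟧) := HasSubst.of_constantCoeff_zero' (by simp)
  have h : rescale a (log K) = (log K).subst (C a * X : K⟦X⟧) := by
    rw [rescale_eq_subst, smul_eq_C_mul]
  rw [h, ← subst_subst _ constantCoeff_log (by simp), exp_subst_log, ← coe_substAlgHom hs, map_add,
    map_one, coe_substAlgHom, subst_X hs]

/-- Writing `φ = X · exp l`, the Böttcher equation for `g = X ^ d (1 + a X)` is the exponential of the
linear equation `d · l = log (1 + a X) + l(g)`. Here `log (1 + a X)` appears as a rescaled `log`. -/
theorem isBottcherCoordinate_X_mul_exp {d : ℕ} (hd : d ≠ 0) (a : K) {l : K⟦X⟧}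
    (hl0 : constantCoeff l = 0)
    (hl : (d : K⟦X⟧) * l = rescale a (log K) + l.subst (X ^ d + C a * X ^ (d + 1) : K⟦X⟧)) :
    IsBottcherCoordinate d (X ^ d + C a * X ^ (d + 1)) (X * (exp K).subst l) where
  coeff_zero := by rw [coeff_zero_X_mul]
  coeff_one := by
    rw [show (1 : ℕ) = 0 + 1 from rfl, coeff_succ_X_mul, coeff_zero_eq_constantCoeff_apply,
      constantCoeff_exp_subst hl0]
  subst_eq := by
    have hg0 : constantCoeff (X ^ d + C a * X ^ (d + 1) : K⟦X⟧) = 0 := by simp [hd]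
    have hs := HasSubst.of_constantCoeff_zero' hg0
    have hlog : constantCoeff (rescale a (log K)) = 0 := by
      rw [← coeff_zero_eq_constantCoeff_apply, coeff_rescale]
      simp
    have hlg : constantCoeff (l.subst (X ^ d + C a * X ^ (d + 1) : K⟦X⟧)) = 0 :=
      constantCoeff_subst_eq_zero hg0 _ hl0
    rw [subst_mul hs, subst_X hs, subst_subst _ hl0 hg0, mul_pow,
      ← exp_subst_natCast_mul hl0, hl, exp_subst_add hlog hlg, exp_subst_rescale_log]
    ring

theorem coeff_exp_subst_C_mul_X_pow (c : K) {N : ℕ} (hN : N ≠ 0) (m : ℕ) :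
    coeff (N * m) ((exp K).subst (C c * X ^ N : K⟦X⟧)) = c ^ m / (m.factorial : K) := by
  rw [coeff_subst' (HasSubst.of_constantCoeff_zero' (by simp [hN])), finsum_eq_single _ m]
  · rw [mul_pow, ← map_pow, ← pow_mul, coeff_C_mul, coeff_X_pow_self, coeff_exp, smul_eq_mul]
    simp
    ring
  · intro d hd
    rw [mul_pow, ← map_pow, ← pow_mul, coeff_C_mul, coeff_X_pow, if_neg, mul_zero, smul_zero]
    intro h
    exact hd (Nat.eq_of_mul_eq_mul_left (Nat.pos_of_ne_zero hN) h).symm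

end ExpLog

/-! ### The linearized functional equation -/

section FunctionalEquation

variable {K : Type*} [Field K]

/-- The `k`-th iterate of `g` under composition, with `g` applied first at each step. -/
noncomputable def substIterate (g : K⟦X⟧) : ℕ → K⟦X⟧
  | 0 => X
  | k + 1 => (substIterate g k).subst g

theorem X_pow_dvd_substIterate {g : K⟦X⟧} (hg : X ^ 2 ∣ g) (k : ℕ) :
    X ^ (k + 1) ∣ substIterate g k := by
  induction k with
  | zero => rw [substIterate, zero_add, pow_one]
  | succ k ih => exact (pow_dvd_pow X (by omega)).trans (X_pow_dvd_subst two_ne_zero hg ih)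

theorem constantCoeff_substIterate {g : K⟦X⟧} (hg : X ^ 2 ∣ g) (k : ℕ) :
    constantCoeff (substIterate g k) = 0 :=
  X_dvd_iff.1 ((dvd_pow_self X k.succ_ne_zero).trans (X_pow_dvd_substIterate hg k))

/-- The equation `l = f + b · l(g)` is solved by the `X`-adically convergent sum `∑ bⁱ f(gⁱ)` over the
iterates of `g`, and the partial sums approximate `l` to increasing order. -/
theorem exists_eq_add_C_mul_subst {g f : K⟦X⟧} (hg : X ^ 2 ∣ g) (hf : constantCoeff f = 0) (b : K) :
    ∃ l : K⟦X⟧, constantCoeff l = 0 ∧ l = f + C b * l.subst g ∧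
      ∀ k, X ^ (k + 1) ∣ l - ∑ i ∈ Finset.range k, C (b ^ i) * f.subst (substIterate g i) := by
  set F : ℕ → K⟦X⟧ := fun k => ∑ i ∈ Finset.range k, C (b ^ i) * f.subst (substIterate g i)
    with hF
  have hg0 : constantCoeff g = 0 := X_dvd_iff.1 ((dvd_pow_self X two_ne_zero).trans hg)
  have hs := HasSubst.of_constantCoeff_zero' hg0
  have hterm : ∀ i, X ^ (i + 1) ∣ C (b ^ i) * f.subst (substIterate g i) := fun i => by
    have := X_pow_dvd_subst (n := 1) (f := f) i.succ_ne_zero (X_pow_dvd_substIterate hg i)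
      (by rw [pow_one]; exact X_dvd_iff.2 hf)
    rw [mul_one] at this
    exact this.mul_left _
  have hdiff : ∀ k j, X ^ (k + 1) ∣ F (k + j) - F k := by
    intro k j
    rw [hF]
    simp only
    rw [Finset.sum_range_add, add_sub_cancel_left]
    exact Finset.dvd_sum fun i _ => (pow_dvd_pow X (by omega)).trans (hterm (k + i))
  have hrec : ∀ k, F (k + 1) = f + C b * (F k).subst g := by
    intro k
    induction k with
    | zero =>
      simp [hF, substIterate, X_subst, ← coe_substAlgHom hs]
    | succ k ih =>
      have h1 : F (k + 1 + 1) = F (k + 1) + C (b ^ (k + 1)) * f.subst (substIterate g (k + 1)) :=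
        Finset.sum_range_succ _ _
      have h2 : F (k + 1) = F k + C (b ^ k) * f.subst (substIterate g k) :=
        Finset.sum_range_succ _ _
      have h3 : subst g (subst (substIterate g k) f : K⟦X⟧) = f.subst (substIterate g (k + 1)) :=
        subst_subst f (constantCoeff_substIterate hg k) hg0
      have h4 : (C (b ^ k) : K⟦X⟧).subst g = C (b ^ k) := subst_C _
      have h5 : (F (k + 1)).subst g = (F k).subst g + C (b ^ k) * f.subst (substIterate g (k + 1)) := by
        rw [h2, subst_add hs, subst_mul hs, h3, h4]
      rw [h1, h5, ih, pow_succ, map_mul]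
      ring
  -- The coefficient of `Xⁿ` is stationary along the partial sums from the `n`-th one on.
  set l : K⟦X⟧ := mk fun n => coeff n (F (n + 1)) with hl
  have happrox : ∀ k, X ^ (k + 1) ∣ l - F k := by
    intro k
    refine X_pow_dvd_iff.2 fun n hn => ?_
    obtain ⟨j, rfl⟩ : ∃ j, k = n + j := ⟨k - n, by omega⟩
    have h1 := X_pow_dvd_iff.1 (hdiff n j) n n.lt_succ_self
    have h2 := X_pow_dvd_iff.1 (hdiff n 1) n n.lt_succ_self
    rw [map_sub, sub_eq_zero] at h1 h2
    rw [map_sub, hl, coeff_mk, h1, h2, sub_self]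
  refine ⟨l, ?_, ?_, happrox⟩
  · have := happrox 0
    rw [show F 0 = 0 from Finset.sum_range_zero _, sub_zero] at this
    exact X_dvd_iff.1 (by simpa using this)
  · refine eq_of_forall_X_pow_dvd_sub fun n => ?_
    have h1 := X_pow_dvd_subst two_ne_zero hg (happrox n)
    rw [subst_sub hs] at h1
    have h2 := happrox (n + 1)
    rw [hrec] at h2
    have h3 : l - (f + C b * l.subst g)
        = (l - (f + C b * (F n).subst g)) - C b * (l.subst g - (F n).subst g) := by ring
    rw [h3]
    exact dvd_sub ((pow_dvd_pow X (by omega)).trans h2)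
      (((pow_dvd_pow X (by omega)).trans h1).mul_left _)

end FunctionalEquation

end PowerSeries

/-! ### Sizes of the terms of the logarithm -/

section RealEstimates

/-- The convex function `t ↦ x ^ t` meets the line `1 + (x - 1) t` at `t = 0` and `t = 1`; at every other
integer it exceeds it by at least `(x - 1) / 2`. -/
theorem one_add_mul_le_zpow {x : ℝ} (hx : 2 ≤ x) {t : ℤ} (h0 : t ≠ 0) (h1 : t ≠ 1) :
    1 + (x - 1) * (t + 1 / 2) ≤ x ^ t := by
  have hx0 : 0 < x := by linarith
  rcases lt_or_ge t 0 with ht | ht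
  · rcases eq_or_ne t (-1) with rfl | ht1
    · rw [zpow_neg_one, ← sub_nonneg]
      have : x⁻¹ - (1 + (x - 1) * (((-1 : ℤ) : ℝ) + 1 / 2)) = (x - 1) * (x - 2) / (2 * x) := by
        push_cast
        field_simp
        ring
      rw [this]
      exact div_nonneg (mul_nonneg (by linarith) (by linarith)) (by linarith)
    · have h2 : (t : ℝ) ≤ -2 := by exact_mod_cast (by omega : t ≤ -2)
      have h3 : 0 < x ^ t := zpow_pos hx0 t
      nlinarith
  · obtain ⟨n, rfl⟩ : ∃ n : ℕ, t = (n + 2 : ℕ) := ⟨(t - 2).toNat, by omega⟩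
    rw [zpow_natCast]
    suffices h : 1 + (x - 1) * (n + 3) ≤ x ^ (n + 2) by
      refine le_trans ?_ h
      push_cast
      nlinarith
    clear h0 h1 ht
    induction n with
    | zero =>
      push_cast
      nlinarith [mul_nonneg (by linarith : 0 ≤ x - 1) (by linarith : 0 ≤ x - 2)]
    | succ n ih =>
      rw [show n + 1 + 2 = n + 2 + 1 by ring, pow_succ]
      have hn : (0 : ℝ) ≤ n := n.cast_nonneg
      have := mul_le_mul_of_nonneg_right ih hx0.le
      push_cast
      nlinarith [mul_nonneg (mul_nonneg (by linarith : 0 ≤ x - 1) (by linarith : 0 ≤ x - 1)) hn]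

theorem natCast_mul_pow_le_half {x : ℝ} (h0 : 0 ≤ x) (h4 : x ≤ 1 / 4) (n : ℕ) :
    ((n + 2 : ℕ) : ℝ) * x ^ (n + 1) ≤ 1 / 2 := by
  induction n with
  | zero =>
    norm_num
    linarith
  | succ n ih =>
    refine le_trans ?_ ih
    rw [pow_succ x (n + 1), mul_left_comm, mul_comm _ (x ^ (n + 1))]
    refine mul_le_mul_of_nonneg_left ?_ (by positivity)
    push_cast
    nlinarith [(n.cast_nonneg : (0 : ℝ) ≤ n)]

/-- The number `p ^ (-1 / (p - 1))`, the radius of convergence of the `p`-adic exponential. -/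
noncomputable def padicExpRadius (p : ℕ) : ℝ :=
  (p : ℝ) ^ (-(1 / ((p : ℝ) - 1)))

/-- The number `p ^ (-p ^ (-r) / (p - 1))`. -/
noncomputable def inverseBottcherRadius (p r : ℕ) : ℝ :=
  (p : ℝ) ^ (-((p : ℝ) ^ (-(r : ℝ)) / ((p : ℝ) - 1)))

theorem padicExpRadius_pos {p : ℕ} (hp : 2 ≤ p) : 0 < padicExpRadius p :=
  Real.rpow_pos_of_pos (by exact_mod_cast (by omega : 0 < p)) _

theorem padicExpRadius_lt_one {p : ℕ} (hp : 2 ≤ p) : padicExpRadius p < 1 := by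
  have h2 : (2 : ℝ) ≤ p := by exact_mod_cast hp
  refine Real.rpow_lt_one_of_one_lt_of_neg (by linarith) ?_
  rw [neg_lt_zero]
  exact div_pos one_pos (by linarith)

/-- Powers of `p ^ (-1 / (p - 1))` with exponent a multiple of `p - 1` are powers of `p⁻¹`. -/
theorem padicExpRadius_pow_mul {p : ℕ} (hp : 2 ≤ p) (v : ℕ) :
    padicExpRadius p ^ ((p - 1) * v) = ((p : ℝ) ^ v)⁻¹ := by
  have h2 : (2 : ℝ) ≤ p := by exact_mod_cast hp
  have h : padicExpRadius p ^ (p - 1) = (p : ℝ)⁻¹ := by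
    rw [padicExpRadius, ← Real.rpow_natCast, ← Real.rpow_mul (by linarith), ← Real.rpow_neg_one]
    congr 1
    rw [Nat.cast_sub (by omega), Nat.cast_one, neg_mul, one_div_mul_cancel (by linarith)]
  rw [pow_mul, h, inv_pow]

theorem inverseBottcherRadius_pos {p : ℕ} (hp : 2 ≤ p) (r : ℕ) : 0 < inverseBottcherRadius p r :=
  Real.rpow_pos_of_pos (by exact_mod_cast (by omega : 0 < p)) _

theorem inverseBottcherRadius_le_one {p : ℕ} (hp : 2 ≤ p) (r : ℕ) : inverseBottcherRadius p r ≤ 1 := by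
  have h2 : (2 : ℝ) ≤ p := by exact_mod_cast hp
  refine Real.rpow_le_one_of_one_le_of_nonpos (by linarith) ?_
  rw [neg_nonpos]
  exact div_nonneg (Real.rpow_nonneg (by linarith) _) (by linarith)

/-- The left-hand side is the Gauss norm of `p ^ (r - 2 k) X ^ (p ^ (2 k))`, the leading part of the
`k`-th term of the logarithm of the Böttcher coordinate. Its `p`-adic size depends only on `2 k - r`. -/
theorem logTerm_size_eq {p : ℕ} (hp : 2 ≤ p) (r k : ℕ) :
    (p : ℝ) ^ (2 * k) * (((p : ℝ) ^ r)⁻¹ * inverseBottcherRadius p r ^ (p ^ 2) ^ k) =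
      (p : ℝ) ^ (((2 * k - r : ℤ) : ℝ) - (p : ℝ) ^ (2 * k - r : ℤ) / ((p : ℝ) - 1)) := by
  have h2 : (2 : ℝ) ≤ p := by exact_mod_cast hp
  have h0 : (0 : ℝ) < p := by linarith
  have h1 : (p : ℝ) - 1 ≠ 0 := by linarith
  rw [inverseBottcherRadius, ← Real.rpow_natCast _ ((p ^ 2) ^ k), ← Real.rpow_mul h0.le,
    ← Real.rpow_natCast _ (2 * k), ← Real.rpow_natCast _ r, ← Real.rpow_neg h0.le,
    ← Real.rpow_add h0, ← Real.rpow_add h0]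
  congr 1
  rw [zpow_sub₀ h0.ne', Real.rpow_neg h0.le, Real.rpow_natCast]
  push_cast
  rw [← pow_mul, zpow_natCast, show (2 * (k : ℤ)) = ((2 * k : ℕ) : ℤ) by push_cast; rfl,
    zpow_natCast]
  field_simp
  ring

theorem logTerm_size_eq_padicExpRadius {p : ℕ} (hp : 2 ≤ p) {r k : ℕ} (h : 2 * k = r ∨ 2 * k = r + 1) :
    (p : ℝ) ^ (2 * k) * (((p : ℝ) ^ r)⁻¹ * inverseBottcherRadius p r ^ (p ^ 2) ^ k) =
      padicExpRadius p := by
  have h2 : (2 : ℝ) ≤ p := by exact_mod_cast hp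
  have h1 : (p : ℝ) - 1 ≠ 0 := by linarith
  rw [logTerm_size_eq hp, padicExpRadius]
  congr 1
  rcases h with h | h
  · rw [show (2 * k - r : ℤ) = 0 by omega]
    simp
  · rw [show (2 * k - r : ℤ) = 1 by omega, zpow_one]
    push_cast
    field_simp
    ring

/-- Exactly one `k` satisfies `2 k = r` or `2 k = r + 1`; every other term is smaller by a factor
`p ^ (-1 / 2) ≤ 3 / 4` at least. -/
theorem logTerm_size_le {p : ℕ} (hp : 2 ≤ p) {r k : ℕ} (h : ¬(2 * k = r ∨ 2 * k = r + 1)) :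
    (p : ℝ) ^ (2 * k) * (((p : ℝ) ^ r)⁻¹ * inverseBottcherRadius p r ^ (p ^ 2) ^ k) ≤
      padicExpRadius p * (3 / 4) := by
  have h2 : (2 : ℝ) ≤ p := by exact_mod_cast hp
  have h0 : (0 : ℝ) < p := by linarith
  have hsqrt : (p : ℝ) ^ (-(1 / 2) : ℝ) ≤ 3 / 4 := by
    rw [Real.rpow_neg h0.le, ← Real.sqrt_eq_rpow, inv_le_comm₀ (Real.sqrt_pos.2 h0) (by norm_num)]
    exact Real.le_sqrt_of_sq_le (by norm_num; linarith)
  rw [logTerm_size_eq hp]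
  have key := one_add_mul_le_zpow h2 (t := 2 * k - r) (by omega) (by omega)
  calc _ ≤ (p : ℝ) ^ (-(1 / ((p : ℝ) - 1)) + -(1 / 2) : ℝ) := by
        refine Real.rpow_le_rpow_of_exponent_le (by linarith) ?_
        have h3 : 1 / ((p : ℝ) - 1) + (((2 * k - r : ℤ) : ℝ) + 1 / 2) ≤
            (p : ℝ) ^ (2 * k - r : ℤ) / ((p : ℝ) - 1) := by
          rw [le_div_iff₀ (by linarith), add_mul, one_div_mul_cancel (by linarith)]
          linarith
        linarith
    _ = padicExpRadius p * (p : ℝ) ^ (-(1 / 2) : ℝ) := by rw [Real.rpow_add h0, padicExpRadius]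
    _ ≤ _ := mul_le_mul_of_nonneg_left hsqrt (padicExpRadius_pos hp).le

end RealEstimates

/-! ### Valuations of factorials -/

section Padic

variable (p : ℕ) [hp : Fact p.Prime] {K : Type*} [NormedField K] [NormedAlgebra ℚ_[p] K]

theorem norm_natCast_eq_padic (n : ℕ) : ‖(n : K)‖ = ‖(n : ℚ_[p])‖ := by
  rw [← map_natCast (algebraMap ℚ_[p] K), norm_algebraMap']

theorem norm_natCast_prime : ‖(p : K)‖ = (p : ℝ)⁻¹ := by
  rw [norm_natCast_eq_padic p, Padic.norm_p]

theorem norm_natCast_eq_inv_pow {n : ℕ} (hn : n ≠ 0) :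
    ‖(n : K)‖ = ((p : ℝ) ^ padicValNat p n)⁻¹ := by
  rw [norm_natCast_eq_padic p, Padic.norm_eq_zpow_neg_valuation (by exact_mod_cast hn),
    Padic.valuation_natCast, zpow_neg, zpow_natCast]

theorem inv_norm_natCast_le (p : ℕ) [Fact p.Prime] {K : Type*} [NormedField K]
    [NormedAlgebra ℚ_[p] K] {n : ℕ} (hn : n ≠ 0) : ‖(n : K)‖⁻¹ ≤ n := by
  rw [norm_natCast_eq_inv_pow p hn, inv_inv]
  exact_mod_cast Nat.le_of_dvd (Nat.pos_of_ne_zero hn) pow_padicValNat_dvd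

/-- Legendre's formula; the number `s` is the sum of the base-`p` digits of `n`. -/
theorem padicExpRadius_pow_div_norm_factorial {n s : ℕ}
    (h : (p - 1) * padicValNat p n.factorial + s = n) :
    padicExpRadius p ^ n / ‖(n.factorial : K)‖ = padicExpRadius p ^ s := by
  have h0 : (0 : ℝ) < p := by exact_mod_cast hp.out.pos
  have he : padicExpRadius p ^ n =
      padicExpRadius p ^ ((p - 1) * padicValNat p n.factorial + s) := by rw [h]
  rw [he, pow_add, padicExpRadius_pow_mul hp.out.two_le, norm_natCast_eq_inv_pow p n.factorial_ne_zero]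
  field_simp

theorem padicExpRadius_pow_div_norm_factorial_le {n : ℕ} (hn : n ≠ 0) :
    padicExpRadius p ^ n / ‖(n.factorial : K)‖ ≤ padicExpRadius p := by
  have h := sub_one_mul_padicValNat_factorial_lt_of_ne_zero (p := p) hn
  rw [padicExpRadius_pow_div_norm_factorial p (s := n - (p - 1) * padicValNat p n.factorial)
    (by omega)]
  exact pow_le_of_le_one (padicExpRadius_pos hp.out.two_le).le
    (padicExpRadius_lt_one hp.out.two_le).le (by omega)

/-- The exponents `pʲ`, whose digit sum is `1`, are those where the terms of the exponential are
largest on the circle of radius `p ^ (-1 / (p - 1))`. -/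
theorem padicExpRadius_pow_div_norm_factorial_prime_pow (j : ℕ) :
    padicExpRadius p ^ p ^ j / ‖((p ^ j).factorial : K)‖ = padicExpRadius p := by
  have h := sub_one_mul_padicValNat_factorial (p := p) (p ^ j)
  have hd : (p.digits (p ^ j)).sum = 1 := by
    have := Nat.digits_base_pow_mul (b := p) (k := j) (m := 1) hp.out.one_lt one_pos
    rw [mul_one] at this
    simp [this, Nat.digits_of_lt p 1 one_ne_zero hp.out.one_lt]
  rw [hd] at h
  have := Nat.one_le_pow j p hp.out.pos
  rw [padicExpRadius_pow_div_norm_factorial p (s := 1) (by omega), pow_one]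

end Padic

namespace PowerSeries

/-! ### The p-adic exponential of an almost monomial series -/

section PadicExp

variable (p : ℕ) [hp : Fact p.Prime] {K : Type*} [NormedField K] [NormedAlgebra ℚ_[p] K]
  [CharZero K]

/-- Inside its disc of convergence, the `p`-adic exponential satisfies `|exp x - 1| ≤ |x|`. -/
theorem gaussBound_exp_sub_one {τ : ℝ} (h0 : 0 ≤ τ) (h1 : τ ≤ 1) :
    GaussBound (padicExpRadius p * τ) (padicExpRadius p * τ) (exp K - 1) := by
  have hc := padicExpRadius_pos hp.out.two_le
  intro n
  rcases eq_or_ne n 0 with rfl | hn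
  · simp
    positivity
  · have : coeff n (exp K - 1) = ((n.factorial : K))⁻¹ := by
      simp [coeff_one, hn]
    rw [this, norm_inv, mul_pow, ← mul_assoc, inv_mul_eq_div]
    exact mul_le_mul (padicExpRadius_pow_div_norm_factorial_le p hn) (pow_le_of_le_one h0 h1 hn)
      (by positivity) hc.le

variable [IsUltrametricDist K]

theorem gaussBound_exp_subst_sub_one {ρ τ : ℝ} (hρ : 0 < ρ) (h0 : 0 ≤ τ) (h1 : τ ≤ 1) {f : K⟦X⟧}
    (hf0 : constantCoeff f = 0) (hf : GaussBound ρ (padicExpRadius p * τ) f) :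
    GaussBound ρ (padicExpRadius p * τ) ((exp K).subst f - 1) := by
  have hs := HasSubst.of_constantCoeff_zero' hf0
  have h := (gaussBound_exp_sub_one (K := K) p h0 h1).subst hf hρ hf0
  rwa [subst_sub hs, ← coe_substAlgHom hs, map_one, coe_substAlgHom] at h

/-- Suppose `f = c X ^ N + (strictly smaller terms)` on the disc of radius `ρ`, where the monomial has
size exactly the radius of convergence of the exponential. Then `exp f` is a bounded series whose
terms of degree `N pʲ` do not tend to zero: they are those of `exp (c X ^ N)`, up to
a strictly smaller error. -/
theorem gaussBound_exp_subst_and_norm_coeff {ρ τ : ℝ} (hρ : 0 < ρ) (h0 : 0 ≤ τ) (h1 : τ < 1)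
    {f : K⟦X⟧} (hf0 : constantCoeff f = 0) {c : K} {N : ℕ} (hN : N ≠ 0)
    (hc : ‖c‖ * ρ ^ N = padicExpRadius p)
    (hf : GaussBound ρ (padicExpRadius p * τ) (f - C c * X ^ N)) :
    GaussBound ρ (padicExpRadius p) ((exp K).subst f - 1) ∧
      ∀ j, ‖coeff (N * p ^ j) ((exp K).subst f)‖ * ρ ^ (N * p ^ j) = padicExpRadius p := by
  have he := padicExpRadius_pos hp.out.two_le
  have hm0 : constantCoeff (C c * X ^ N : K⟦X⟧) = 0 := by simp [hN]
  have hd0 : constantCoeff (f - C c * X ^ N) = 0 := by rw [map_sub, hf0, hm0, sub_zero]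
  have hm : GaussBound ρ (padicExpRadius p) (C c * X ^ N : K⟦X⟧) :=
    hc ▸ GaussBound.monomial hρ.le c N
  have hM : GaussBound ρ (padicExpRadius p) ((exp K).subst (C c * X ^ N : K⟦X⟧) - 1) := by
    simpa using gaussBound_exp_subst_sub_one p hρ zero_le_one le_rfl hm0 (by simpa using hm)
  have hD := gaussBound_exp_subst_sub_one p hρ h0 h1.le hd0 hf
  set M := (exp K).subst (C c * X ^ N : K⟦X⟧) with hMdef
  set D := (exp K).subst (f - C c * X ^ N) with hDdef
  have hprod : (exp K).subst f = M + M * (D - 1) := by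
    rw [mul_sub, mul_one, add_sub_cancel, hMdef, hDdef, ← exp_subst_add hm0 hd0, add_sub_cancel]
  have hM1 : GaussBound ρ 1 M := by
    have := (hM.mono (padicExpRadius_lt_one hp.out.two_le).le).add (GaussBound.one hρ.le) hρ.le
    rwa [sub_add_cancel] at this
  have hMD : GaussBound ρ (padicExpRadius p * τ) (M * (D - 1)) := by
    simpa using hM1.mul hD hρ.le
  constructor
  · rw [hprod, add_sub_right_comm]
    exact hM.add (hMD.mono (mul_le_of_le_one_right he.le h1.le)) hρ.le
  · intro j
    have hMj : ‖coeff (N * p ^ j) M‖ * ρ ^ (N * p ^ j) = padicExpRadius p := by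
      rw [hMdef, coeff_exp_subst_C_mul_X_pow c hN, norm_div, norm_pow, pow_mul, div_mul_eq_mul_div,
        ← mul_pow, hc, padicExpRadius_pow_div_norm_factorial_prime_pow]
    have hlt : ‖coeff (N * p ^ j) (M * (D - 1))‖ < ‖coeff (N * p ^ j) M‖ := by
      refine lt_of_mul_lt_mul_right ?_ (pow_nonneg hρ.le (N * p ^ j))
      rw [hMj]
      exact (hMD _).trans_lt (mul_lt_of_lt_one_right he h1)
    rw [hprod, map_add, IsUltrametricDist.norm_add_eq_max_of_norm_ne_norm hlt.ne',
      max_eq_left hlt.le, hMj]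

end PadicExp

/-! ### The logarithm of the Böttcher coordinate -/

section Logarithm

variable (p : ℕ) [hp : Fact p.Prime] {K : Type*} [NormedField K] [NormedAlgebra ℚ_[p] K]

theorem norm_prime_pow_le_quarter (r : ℕ) : ‖(p : K) ^ (r + 2)‖ ≤ 1 / 4 := by
  have h2 : (2 : ℝ) ≤ p := by exact_mod_cast hp.out.two_le
  have h : (p : ℝ)⁻¹ ≤ 2⁻¹ := inv_anti₀ two_pos h2
  have h0 : (0 : ℝ) ≤ (p : ℝ)⁻¹ := by positivity
  rw [norm_pow, norm_natCast_prime p]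
  calc _ ≤ ((p : ℝ)⁻¹) ^ 2 := pow_le_pow_of_le_one h0 (h.trans (by norm_num)) (by omega)
    _ ≤ (2⁻¹) ^ 2 := pow_le_pow_left₀ h0 h 2
    _ = 1 / 4 := by norm_num

/-- The `k`-th iterate of `X ^ d (1 + a X)` is close to `X ^ (d ^ k)` on every disc inside the unit disc.
The induction applies the previous case on the disc of radius `ρ ^ d`, to which the series maps the
disc of radius `ρ`. -/
theorem gaussBound_substIterate_sub [IsUltrametricDist K] {a : K} (ha : ‖a‖ ≤ 1 / 4) {d : ℕ}
    (hd : d ≠ 0) (k : ℕ) {ρ : ℝ} (h0 : 0 < ρ) (h1 : ρ ≤ 1) :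
    GaussBound ρ (ρ ^ d ^ k * (1 / 4))
      (substIterate (X ^ d + C a * X ^ (d + 1)) k - X ^ d ^ k) := by
  set g : K⟦X⟧ := X ^ d + C a * X ^ (d + 1) with hg
  have hg0 : constantCoeff g = 0 := by simp [hg, hd]
  have hs := HasSubst.of_constantCoeff_zero' hg0
  induction k generalizing ρ with
  | zero =>
    rw [substIterate, pow_zero, pow_one, pow_one, sub_self]
    intro n
    simp
    positivity
  | succ k ih =>
    have hgX : GaussBound ρ (ρ ^ d * (1 / 4)) (g - X ^ d) := by
      rw [hg, add_sub_cancel_left]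
      refine (GaussBound.monomial h0.le a (d + 1)).mono ?_
      calc _ ≤ 1 / 4 * ρ ^ d :=
            mul_le_mul ha (pow_le_pow_of_le_one h0.le h1 (by omega)) (by positivity) (by norm_num)
        _ = _ := mul_comm _ _
    have hX := GaussBound.X_pow (K := K) h0.le d
    have hgd : GaussBound ρ (ρ ^ d) g := by
      have := (hgX.mono (mul_le_of_le_one_right (by positivity) (by norm_num))).add hX h0.le
      rwa [sub_add_cancel] at this
    have e1 := (ih (pow_pos h0 d) (pow_le_one₀ h0.le h1)).subst hgd h0 hg0
    rw [subst_sub hs, subst_pow hs, subst_X hs, ← pow_mul, ← pow_succ'] at e1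
    have e2 := hgd.pow_sub_pow hX hgX (by norm_num) h0.le (d ^ k)
    rw [← pow_mul, ← pow_mul, ← pow_succ'] at e2
    have := e1.add e2 h0.le
    rwa [sub_add_sub_cancel] at this

/-- The series `p⁻² log (1 + p ^ (r + 2) X)` is `p ^ r X` up to half of its size: the term of degree
`n ≥ 2` is smaller than the linear one by `n · 4 ^ (1 - n) ≤ 1 / 2`. -/
theorem gaussBound_log_sub_linear [CharZero K] (r : ℕ) {ρ : ℝ} (h0 : 0 ≤ ρ) (h1 : ρ ≤ 1) :
    GaussBound ρ (((p : ℝ) ^ r)⁻¹ * ρ * (1 / 2))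
      (C (((p ^ 2 : ℕ) : K)⁻¹) * rescale ((p : K) ^ (r + 2)) (log K) - C ((p : K) ^ r) * X) := by
  have hp0 : (0 : ℝ) < p := by exact_mod_cast hp.out.pos
  have hpK : (p : K) ≠ 0 := by exact_mod_cast hp.out.ne_zero
  have hB : 0 ≤ ((p : ℝ) ^ r)⁻¹ * ρ * (1 / 2) := by positivity
  intro n
  rw [map_sub, coeff_C_mul, coeff_rescale, coeff_C_mul, coeff_X, coeff_log]
  rcases n with _ | _ | n
  · simpa using hB
  · have : ((p : K) ^ 2)⁻¹ * (p : K) ^ (r + 2) - (p : K) ^ r = 0 := by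
      rw [pow_add, mul_comm, mul_assoc, mul_inv_cancel₀ (pow_ne_zero 2 hpK), mul_one, sub_self]
    have hgoal : ‖((p : K) ^ 2)⁻¹ * (p : K) ^ (r + 2) - (p : K) ^ r‖ * ρ ≤
        ((p : ℝ) ^ r)⁻¹ * ρ * (1 / 2) := by
      rw [this, norm_zero, zero_mul]
      exact hB
    simpa using hgoal
  · rw [if_neg (by omega), if_neg (by omega), mul_zero, sub_zero, eq_ratCast, norm_mul, norm_mul,
      norm_inv, norm_pow]
    have hlog : ‖(((-1 : ℚ) ^ (n + 1 + 1 + 1) / ((n + 1 + 1 : ℕ) : ℚ) : ℚ) : K)‖ ≤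
        ((n + 2 : ℕ) : ℝ) := by
      rw [Rat.cast_div, norm_div, Rat.cast_pow, norm_pow, Rat.cast_neg, Rat.cast_one, norm_neg,
        norm_one, one_pow, one_div, Rat.cast_natCast]
      exact inv_norm_natCast_le p (by omega)
    have hq : ‖((p ^ 2 : ℕ) : K)‖⁻¹ * ‖(p : K) ^ (r + 2)‖ = ((p : ℝ) ^ r)⁻¹ := by
      rw [Nat.cast_pow, norm_pow, norm_pow, norm_natCast_prime p, pow_add, inv_pow, inv_pow, inv_inv]
      field_simp
    have hx := norm_prime_pow_le_quarter (K := K) p r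
    set x := ‖(p : K) ^ (r + 2)‖ with hxdef
    have hx0 : 0 ≤ x := norm_nonneg _
    calc _ ≤ ‖((p ^ 2 : ℕ) : K)‖⁻¹ * (x ^ (n + 1 + 1) * ((n + 2 : ℕ) : ℝ)) * (ρ * 1) := by
          gcongr
          rw [pow_succ']
          gcongr
          exact pow_le_one₀ h0 h1
      _ = (‖((p ^ 2 : ℕ) : K)‖⁻¹ * x) * ρ * (((n + 2 : ℕ) : ℝ) * x ^ (n + 1)) := by ring
      _ ≤ _ := by
          rw [hq]
          exact mul_le_mul_of_nonneg_left (natCast_mul_pow_le_half hx0 hx n) (by positivity)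

variable [CharZero K] [IsUltrametricDist K]

/-- The `k`-th term `p ^ (-2 k) · p⁻² log (1 + p ^ (r + 2) gᵏ)` of the logarithm is its leading monomial
`p ^ (r - 2 k) X ^ (p ^ (2 k))` up to half of its size. -/
theorem gaussBound_logTerm_sub (r k : ℕ) {ρ : ℝ} (h0 : 0 < ρ) (h1 : ρ ≤ 1) :
    GaussBound ρ ((p : ℝ) ^ (2 * k) * (((p : ℝ) ^ r)⁻¹ * ρ ^ (p ^ 2) ^ k) * (1 / 2))
      (C (((p ^ 2 : ℕ) : K)⁻¹ ^ k) *
          (C (((p ^ 2 : ℕ) : K)⁻¹) * rescale ((p : K) ^ (r + 2)) (log K)).subst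
            (substIterate (X ^ p ^ 2 + C ((p : K) ^ (r + 2)) * X ^ (p ^ 2 + 1)) k) -
        C (((p ^ 2 : ℕ) : K)⁻¹ ^ k * (p : K) ^ r) * X ^ (p ^ 2) ^ k) := by
  have hp0 : (0 : ℝ) < p := by exact_mod_cast hp.out.pos
  have hd : p ^ 2 ≠ 0 := pow_ne_zero 2 hp.out.ne_zero
  set q : K := ((p ^ 2 : ℕ) : K)⁻¹ with hq
  set f : K⟦X⟧ := C q * rescale ((p : K) ^ (r + 2)) (log K) with hf
  set G := substIterate (X ^ p ^ 2 + C ((p : K) ^ (r + 2)) * X ^ (p ^ 2 + 1)) k with hG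
  have hG0 : constantCoeff G = 0 := by
    refine constantCoeff_substIterate ?_ k
    have h2 : 2 ≤ p ^ 2 := hp.out.two_le.trans (Nat.le_self_pow two_ne_zero p)
    exact dvd_add (pow_dvd_pow X h2) ((pow_dvd_pow X (by omega)).mul_left _)
  have hs := HasSubst.of_constantCoeff_zero' hG0
  have e1 : GaussBound ρ (ρ ^ (p ^ 2) ^ k * (1 / 4)) (G - X ^ (p ^ 2) ^ k) :=
    gaussBound_substIterate_sub (norm_prime_pow_le_quarter p r) hd k h0 h1
  have e2 : GaussBound ρ (ρ ^ (p ^ 2) ^ k) G := by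
    have := (e1.mono (mul_le_of_le_one_right (by positivity) (by norm_num))).add
      (GaussBound.X_pow (K := K) h0.le _) h0.le
    rwa [sub_add_cancel] at this
  have e3 := (gaussBound_log_sub_linear (K := K) p r (pow_nonneg h0.le ((p ^ 2) ^ k))
    (pow_le_one₀ h0.le h1)).subst e2 h0 hG0
  have hC : (C ((p : K) ^ r) : K⟦X⟧).subst G = C ((p : K) ^ r) := subst_C _
  rw [← hq, ← hf, subst_sub hs, subst_mul hs (C ((p : K) ^ r)), subst_X hs, hC] at e3
  have hnorm : ‖(p : K) ^ r‖ = ((p : ℝ) ^ r)⁻¹ := by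
    rw [norm_pow, norm_natCast_prime p, inv_pow]
  have e4 := (e3.add ((e1.C_mul ((p : K) ^ r)).mono (by
    rw [hnorm, ← mul_assoc]
    exact mul_le_mul_of_nonneg_left (by norm_num) (by positivity))) h0.le).C_mul (q ^ k)
  have hqn : ‖q ^ k‖ = (p : ℝ) ^ (2 * k) := by
    rw [hq, norm_pow, norm_inv, Nat.cast_pow, norm_pow, norm_natCast_prime p, inv_pow, inv_pow,
      inv_pow, inv_inv, pow_mul]
  rw [hqn, ← mul_assoc] at e4
  convert e4 using 1
  rw [map_mul]
  ring

/-- The logarithm of `φ / X` is dominated, on the disc of radius `p ^ (-p ^ (-r) / (p - 1))`, by a single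
monomial, whose size there is the radius of convergence of the exponential. -/
theorem exists_bottcher_log (r : ℕ) :
    ∃ l : K⟦X⟧, constantCoeff l = 0 ∧
      ((p ^ 2 : ℕ) : K⟦X⟧) * l = rescale ((p : K) ^ (r + 2)) (log K) +
        l.subst (X ^ p ^ 2 + C ((p : K) ^ (r + 2)) * X ^ (p ^ 2 + 1) : K⟦X⟧) ∧
      ∃ (c : K) (N : ℕ), N ≠ 0 ∧
        ‖c‖ * inverseBottcherRadius p r ^ N = padicExpRadius p ∧
        GaussBound (inverseBottcherRadius p r) (padicExpRadius p * (3 / 4)) (l - C c * X ^ N) := by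
  have h2 := hp.out.two_le
  have he := padicExpRadius_pos h2
  have hR0 := inverseBottcherRadius_pos h2 r
  have hR1 := inverseBottcherRadius_le_one h2 r
  have hqK : ((p ^ 2 : ℕ) : K) ≠ 0 := by exact_mod_cast pow_ne_zero 2 hp.out.ne_zero
  set R := inverseBottcherRadius p r
  set g : K⟦X⟧ := X ^ p ^ 2 + C ((p : K) ^ (r + 2)) * X ^ (p ^ 2 + 1) with hg
  set q : K := ((p ^ 2 : ℕ) : K)⁻¹ with hq
  set f : K⟦X⟧ := C q * rescale ((p : K) ^ (r + 2)) (log K) with hf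
  have hX2 : X ^ 2 ∣ g := by
    have h3 : 2 ≤ p ^ 2 := h2.trans (Nat.le_self_pow two_ne_zero p)
    exact dvd_add (pow_dvd_pow X h3) ((pow_dvd_pow X (by omega)).mul_left _)
  have hf0 : constantCoeff f = 0 := by
    rw [hf, map_mul, ← coeff_zero_eq_constantCoeff_apply (rescale _ _), coeff_rescale]
    simp
  obtain ⟨l, hl0, hl, happrox⟩ := exists_eq_add_C_mul_subst hX2 hf0 q
  refine ⟨l, hl0, ?_, ?_⟩
  · have hqC : ((p ^ 2 : ℕ) : K⟦X⟧) * C q = 1 := by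
      rw [← map_natCast (C : K →+* K⟦X⟧), ← map_mul, hq, mul_inv_cancel₀ hqK, map_one]
    conv_lhs => rw [hl]
    rw [mul_add, hf, ← mul_assoc, ← mul_assoc, hqC, one_mul, one_mul]
  -- The dominant term has index `⌈r / 2⌉`, so that `2 k₀ - r` is `0` or `1`.
  set k₀ := (r + 1) / 2 with hk₀
  have hsize := logTerm_size_eq_padicExpRadius h2 (r := r) (k := k₀) (by omega)
  have hle : ∀ k, (p : ℝ) ^ (2 * k) * (((p : ℝ) ^ r)⁻¹ * R ^ (p ^ 2) ^ k) ≤ padicExpRadius p := by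
    intro k
    by_cases h : 2 * k = r ∨ 2 * k = r + 1
    · exact (logTerm_size_eq_padicExpRadius h2 h).le
    · exact (logTerm_size_le h2 h).trans (mul_le_of_le_one_right he.le (by norm_num))
  have hnorm : ∀ k, ‖q ^ k * (p : K) ^ r‖ * R ^ (p ^ 2) ^ k =
      (p : ℝ) ^ (2 * k) * (((p : ℝ) ^ r)⁻¹ * R ^ (p ^ 2) ^ k) := by
    intro k
    rw [norm_mul, hq, norm_pow, norm_inv, Nat.cast_pow, norm_pow, norm_pow, norm_natCast_prime p,
      inv_pow, inv_pow, inv_pow, inv_pow, inv_inv, ← pow_mul, mul_assoc]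
  refine ⟨q ^ k₀ * (p : K) ^ r, (p ^ 2) ^ k₀, pow_ne_zero _ (pow_ne_zero 2 hp.out.ne_zero),
    (hnorm k₀).trans hsize, ?_⟩
  have hterm : ∀ k, GaussBound R (padicExpRadius p * (3 / 4))
      (C (q ^ k) * f.subst (substIterate g k) - C (q ^ k * (p : K) ^ r) * X ^ (p ^ 2) ^ k) :=
    fun k => (gaussBound_logTerm_sub p r k hR0 hR1).mono
      (mul_le_mul (hle k) (by norm_num) (by norm_num) he.le)
  have hfin : ∀ n, GaussBound R (padicExpRadius p * (3 / 4))
      (∑ i ∈ Finset.range (n + k₀ + 1), C (q ^ i) * f.subst (substIterate g i) -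
        C (q ^ k₀ * (p : K) ^ r) * X ^ (p ^ 2) ^ k₀) := by
    intro n
    rw [← Finset.add_sum_erase _ _ (Finset.mem_range.2 (by omega : k₀ < n + k₀ + 1)),
      add_sub_right_comm]
    refine (hterm k₀).add (GaussBound.sum (by positivity) hR0.le fun k hk => ?_) hR0.le
    have hk0 : k ≠ k₀ := (Finset.mem_erase.1 hk).1
    have hmon := (GaussBound.monomial hR0.le (q ^ k * (p : K) ^ r) ((p ^ 2) ^ k)).mono
      ((hnorm k).le.trans (logTerm_size_le h2 (r := r) (k := k) (by omega)))
    have := (hterm k).add hmon hR0.le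
    rwa [sub_add_cancel] at this
  intro n
  have hn := X_pow_dvd_iff.1 (happrox (n + k₀ + 1)) n (by omega)
  rw [map_sub, sub_eq_zero] at hn
  have := hfin n n
  rwa [map_sub, ← hn, ← map_sub] at this

end Logarithm

/-! ### Gauss norm of the compositional inverse -/

section Inverse

variable {K : Type*} [NormedField K] [IsUltrametricDist K]

/-- The compositional inverse `ψ` of `X + h` maps the disc of radius `ρ` to itself when `h` does.
By `coeff_subst_eq_of_X_pow_dvd_sub` the coefficient of `Xⁿ` in `h(ψ)` depends only on the truncation
of `ψ` below degree `n`, to which the bound already applies. -/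
theorem gaussBound_of_add_subst_eq_X {ρ c : ℝ} (hρ : 0 < ρ) (hc : c ≤ 1)
    {h ψ : K⟦X⟧} (hh : GaussBound ρ (ρ * c) h) (h1 : coeff 1 h = 0) (hψ0 : constantCoeff ψ = 0)
    (hψ : ψ + h.subst ψ = X) : GaussBound ρ ρ ψ := by
  have hψn : ∀ n, coeff n ψ = coeff n (X - h.subst ψ) := fun n => by rw [← hψ, add_sub_cancel_right]
  intro n
  induction n using Nat.strong_induction_on with
  | _ n ih =>
    set T : K⟦X⟧ := mk fun m => if m < n then coeff m ψ else 0 with hT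
    have hTb : GaussBound ρ ρ T := by
      intro m
      rw [hT, coeff_mk]
      split_ifs with hm
      · exact ih m hm
      · simpa using hρ.le
    have hT0 : constantCoeff T = 0 := by
      rw [← coeff_zero_eq_constantCoeff_apply, hT, coeff_mk]
      split_ifs
      · rwa [coeff_zero_eq_constantCoeff_apply]
      · rfl
    have hTψ : X ^ n ∣ ψ - T := by
      refine X_pow_dvd_iff.2 fun m hm => ?_
      rw [map_sub, hT, coeff_mk, if_pos hm, sub_self]
    rw [hψn, map_sub, coeff_subst_eq_of_X_pow_dvd_sub hψ0 hT0 hTψ h1, ← map_sub]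
    exact (GaussBound.X hρ.le).sub
      ((hh.subst hTb hρ hT0).mono (mul_le_of_le_one_right hρ.le hc)) hρ.le n

/-- To first order, the compositional inverse of `X + h` is `X - h`. -/
theorem gaussBound_add_sub_X {ρ c : ℝ} (hρ : 0 < ρ) (hc0 : 0 ≤ c) (hc : c ≤ 1)
    {h ψ : K⟦X⟧} (hh : GaussBound ρ (ρ * c) h) (h1 : coeff 1 h = 0) (hψ0 : constantCoeff ψ = 0)
    (hψ : ψ + h.subst ψ = X) : GaussBound ρ (ρ * c * c) (ψ + h - X) := by
  have hb := gaussBound_of_add_subst_eq_X hρ hc hh h1 hψ0 hψ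
  have hX0 : constantCoeff (X : K⟦X⟧) = 0 := constantCoeff_X
  have hsub : GaussBound ρ (ρ * c) (X - ψ) := by
    rw [← hψ, add_sub_cancel_left]
    exact hh.subst hb hρ hψ0
  have := hh.subst_sub_subst (GaussBound.X hρ.le) hb hsub hc0 hρ hX0 hψ0
  rw [X_subst] at this
  convert this using 1
  rw [← hψ]
  ring

end Inverse

end PowerSeries

/-! ### The radius of convergence -/

/-- If `‖uₙ‖ Rⁿ` is bounded and does not tend to zero, then the radius of convergence is `R`. -/
theorem radius_ofScalars_eq {K : Type*} [NontriviallyNormedField K] {u : ℕ → K} {R B b : ℝ}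
    (hR : 0 < R) (hb : 0 < b) (hle : ∀ n, ‖u n‖ * R ^ n ≤ B)
    (hge : ∀ m, ∃ n ≥ m, b ≤ ‖u n‖ * R ^ n) :
    (FormalMultilinearSeries.ofScalars K u).radius = ENNReal.ofReal R := by
  apply le_antisymm
  · refine ENNReal.le_of_forall_nnreal_lt fun s hs => ?_
    rw [ENNReal.ofReal, ENNReal.coe_le_coe]
    obtain ⟨M, hM0, hM⟩ := FormalMultilinearSeries.norm_mul_pow_le_of_lt_radius _ hs
    by_contra! hlt
    have hRs : R < s := by
      rw [← Real.coe_toNNReal R hR.le]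
      exact_mod_cast hlt
    have h1 : 1 < s / R := (one_lt_div hR).2 hRs
    obtain ⟨m, hm⟩ := pow_unbounded_of_one_lt (M / b) h1
    obtain ⟨n, hn, hbn⟩ := hge m
    have h3 := hM n
    rw [FormalMultilinearSeries.ofScalars_norm] at h3
    have h4 : M / b < (s / R) ^ n := hm.trans_le (pow_le_pow_right₀ h1.le hn)
    rw [div_lt_iff₀ hb] at h4
    have h5 : ‖u n‖ * (s : ℝ) ^ n = (s / R) ^ n * (‖u n‖ * R ^ n) := by
      rw [div_pow]
      field_simp
    have h6 : (s / R) ^ n * b ≤ (s / R) ^ n * (‖u n‖ * R ^ n) :=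
      mul_le_mul_of_nonneg_left hbn (by positivity)
    linarith
  · refine FormalMultilinearSeries.le_radius_of_bound _ B fun n => ?_
    rw [FormalMultilinearSeries.ofScalars_norm, Real.coe_toNNReal R hR.le]
    exact hle n

/-- The statement over any field with an absolute value extending that of `ℚ_[p]`; only the coefficients
are involved, so neither completeness nor algebraic closedness plays a role. -/
theorem exists_bottcherCoordinate_inverse_radius (p : ℕ) [hp : Fact p.Prime] (r : ℕ) {K : Type*}
    [NontriviallyNormedField K] [NormedAlgebra ℚ_[p] K] [CharZero K] [IsUltrametricDist K] :
    ∃ φ ψ : K⟦X⟧,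
      IsBottcherCoordinate (p ^ 2)
        (PowerSeries.X ^ p ^ 2 + PowerSeries.C ((p : K) ^ (r + 2)) * PowerSeries.X ^ (p ^ 2 + 1)) φ ∧
      IsCompInverse φ ψ ∧
      (FormalMultilinearSeries.ofScalars K fun n => PowerSeries.coeff n ψ).radius =
        ENNReal.ofReal (inverseBottcherRadius p r) := by
  open PowerSeries in
  have h2 := hp.out.two_le
  have he := padicExpRadius_pos h2
  have he1 := padicExpRadius_lt_one h2
  have hR := inverseBottcherRadius_pos h2 r
  obtain ⟨l, hl0, hl, c, N, hN, hc, hlc⟩ := exists_bottcher_log (K := K) p r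
  obtain ⟨hu, huN⟩ := gaussBound_exp_subst_and_norm_coeff p hR (by norm_num) (by norm_num) hl0 hN
    hc hlc
  have hφ := isBottcherCoordinate_X_mul_exp (pow_ne_zero 2 hp.out.ne_zero) _ hl0 hl
  set u := (exp K).subst l with hudef
  obtain ⟨ψ, hψ⟩ := exists_isCompInverse (φ := X * u)
    (by rw [map_mul, constantCoeff_X, zero_mul]) (by rw [hφ.coeff_one]; exact isUnit_one)
  refine ⟨X * u, ψ, hφ, hψ, ?_⟩
  set R := inverseBottcherRadius p r
  set e := padicExpRadius p
  have hs := HasSubst.of_constantCoeff_zero' hψ.constantCoeff_right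
  set h : K⟦X⟧ := X * (u - 1) with hh
  have hhb : GaussBound R (R * e) h := (GaussBound.X hR.le).mul hu hR.le
  have hXu : X * u = X + h := by rw [hh]; ring
  have h1 : coeff 1 h = 0 := by
    have := hφ.coeff_one
    rw [hXu, map_add, coeff_one_X] at this
    exact add_eq_left.1 this
  have heq : ψ + h.subst ψ = X := by
    have := hψ.left_subst_right
    rwa [hXu, subst_add hs, subst_X hs] at this
  have hb := gaussBound_of_add_subst_eq_X hR he1.le hhb h1 hψ.constantCoeff_right heq
  have hb2 := gaussBound_add_sub_X hR he.le he1.le hhb h1 hψ.constantCoeff_right heq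
  refine radius_ofScalars_eq hR (mul_pos hR he) hb fun m => ?_
  refine ⟨N * p ^ m + 1, ?_, ?_⟩
  · calc m ≤ p ^ m := (Nat.lt_pow_self hp.out.one_lt).le
      _ ≤ N * p ^ m := Nat.le_mul_of_pos_left _ (Nat.pos_of_ne_zero hN)
      _ ≤ _ := Nat.le_succ _
  · set n := N * p ^ m with hn
    have hn0 : n ≠ 0 := mul_ne_zero hN (pow_ne_zero _ hp.out.ne_zero)
    have hcoeff : coeff (n + 1) h = coeff n u := by
      rw [hh, coeff_succ_X_mul, map_sub, coeff_one, if_neg hn0, sub_zero]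
    have hnorm : ‖coeff (n + 1) h‖ * R ^ (n + 1) = R * e := by
      rw [hcoeff, pow_succ, ← mul_assoc, huN m, mul_comm]
    have hX : coeff (n + 1) (ψ + h - X) = coeff (n + 1) h - -coeff (n + 1) ψ := by
      rw [map_sub, map_add, coeff_X, if_neg (by omega)]
      ring
    -- The error in `ψ ≈ X - h` is of size `R e²`, below the size `R e` of this term of `h`.
    have hlt : ‖coeff (n + 1) (ψ + h - X)‖ < ‖coeff (n + 1) h‖ := by
      refine lt_of_mul_lt_mul_right ?_ (pow_nonneg hR.le (n + 1))
      rw [hnorm]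
      exact (hb2 _).trans_lt (mul_lt_of_lt_one_right (mul_pos hR he) he1)
    rw [hX] at hlt
    have hψn : ‖coeff (n + 1) ψ‖ = ‖coeff (n + 1) h‖ := by
      rw [← norm_neg (coeff (n + 1) ψ)]
      by_contra hne
      rw [sub_eq_add_neg, IsUltrametricDist.norm_add_eq_max_of_norm_ne_norm
        (by rw [norm_neg]; exact Ne.symm hne)] at hlt
      exact absurd (le_max_left _ _) hlt.not_ge
    rw [hψn, hnorm]

theorem corollary1p4 (p : ℕ) [Fact p.Prime] (r : ℕ) :
    ∃ φ ψ : ℂ_[p]⟦X⟧,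
      (IsBottcherCoordinate (p ^ 2) (salernoSilvermanMap p r) φ ∧
        ∀ φ', IsBottcherCoordinate (p ^ 2) (salernoSilvermanMap p r) φ' → φ' = φ) ∧
      (IsCompInverse φ ψ ∧ ∀ ψ', IsCompInverse φ ψ' → ψ' = ψ) ∧
      padicRadiusOfConvergence p ψ =
        ENNReal.ofReal ((p : ℝ) ^ (-((p : ℝ) ^ (-(r : ℝ)) / ((p : ℝ) - 1)))) := by
  obtain ⟨φ, ψ, hφ, hψ, hrad⟩ := exists_bottcherCoordinate_inverse_radius p r (K := ℂ_[p])
  have h2 : 2 ≤ p ^ 2 := (Fact.out : p.Prime).two_le.trans (Nat.le_self_pow two_ne_zero p)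
  have hdvd : PowerSeries.X ^ p ^ 2 ∣ salernoSilvermanMap p r :=
    dvd_add dvd_rfl ((pow_dvd_pow PowerSeries.X (Nat.le_succ _)).mul_left _)
  exact ⟨φ, ψ, ⟨hφ, fun φ' h => PowerSeries.bottcherCoordinate_unique h2 hdvd hφ h⟩,
    ⟨hψ, fun ψ' h => PowerSeries.isCompInverse_unique hψ h⟩, hrad⟩
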